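/- Let $d\ge 1$, let $\Omega\subset\mathbb{R}^d$ be a bounded open set (no regularity of $\partial\Omega$ is assumed), and let $\theta\in\mathbb{R}^d$ with $|\theta|=1$. Let $u\in L^2(\Omega)$ be a real-valued function having a weak derivative $\partial_\theta u\in L^2(\Omega)$ along $\theta$, i.e. $\int_\Omega u\,(\theta\cdot\nabla\varphi)\,dx=-\int_\Omega \partial_\theta u\,\varphi\,dx$ for all $\varphi\in C_c^\infty(\Omega)$. Let $H_\theta=\{y\in\mathbb{R}^d: y\cdot\theta=0\}$, equipped with its $(d-1)$-dimensional Lebesgue measure $\lambda^{d-1}$ (the unit point mass if $d=1$), let $P_\theta(\Omega)\subset H_\theta$ be the orthogonal projection of $\Omega$ onto $H_\theta$, and for $y\in H_\theta$ let $\omega_\theta(y)=\{s\in\mathbb{R}: s\theta+y\in\Omega\}$, a bounded open subset of $\mathbb{R}$. Then there exists a function $g:\partial\Omega\to\mathbb{R}$, measurable for the Borel $\sigma$-algebra of $\partial\Omega$, which is a directional trace of $u$ in the direction $\theta$; that is, there exist a representative of $u$, again denoted by $u$, and a set $A\subset P_\theta(\Omega)$ with $\lambda^{d-1}(P_\theta(\Omega)\setminus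 A)=0$ such that for every $y\in A$: 1. the function $u_{\theta,y}: s\mapsto u(s\theta+y)$ belongs to $H^1(\omega_\theta(y))$; 2. for every connected component $]\alpha,\beta[$ of $\omega_\theta(y)$, the function $u_{\theta,y}$ is continuous on $]\alpha,\beta[$ and extends continuously to $]\alpha,\beta]$, and the value of this extension at $\beta$ is $g(\beta\theta+y)$ (where $\beta\theta+y\in\partial\Omega$). -/

import Mathlib

open MeasureTheory Set Filter Topology
open scoped ContDiff

/-- `v` is the directional derivative of `u` along `θ` on `Ω` in the weak sense:
`∫_Ω u ∂_θ φ = - ∫_Ω v φ` for all `φ ∈ C_c^∞(Ω)`. -/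
def HasWeakDirDeriv {E : Type*} [NormedAddCommGroup E] [NormedSpace ℝ E] [MeasureSpace E]
    (Ω : Set E) (θ : E) (u v : E → ℝ) : Prop :=
  ∀ φ : E → ℝ, ContDiff ℝ ∞ φ → HasCompactSupport φ → tsupport φ ⊆ Ω →
    ∫ x in Ω, u x * fderiv ℝ φ x θ = - ∫ x in Ω, v x * φ x

/-- `u` represents an element of `W_θ(Ω)`: `u ∈ L²(Ω)` and `∂_θ u ∈ L²(Ω)`. -/
def MemW {E : Type*} [NormedAddCommGroup E] [NormedSpace ℝ E] [MeasureSpace E]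
    (Ω : Set E) (θ : E) (u : E → ℝ) : Prop :=
  MemLp u 2 (volume.restrict Ω) ∧
    ∃ v : E → ℝ, MemLp v 2 (volume.restrict Ω) ∧ HasWeakDirDeriv Ω θ u v

/-- `f` represents an element of `H¹(U)`, for `U ⊆ ℝ` open
(on the real line, `fderiv ℝ φ s 1 = deriv φ s`). -/
def MemH1 (U : Set ℝ) (f : ℝ → ℝ) : Prop :=
  MemW U (1 : ℝ) f

/-- The hyperplane `H_θ` through `0` orthogonal to `θ`. -/
noncomputable abbrev hyperplane {d : ℕ} (θ : EuclideanSpace ℝ (Fin d)) :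
    Submodule ℝ (EuclideanSpace ℝ (Fin d)) :=
  (Submodule.span ℝ {θ})ᗮ

/-- The Lebesgue measure `λ^{d-1}` of the Euclidean space `H_θ`. The instance is given explicitly,
since the restriction of the `d`-dimensional Lebesgue measure to the subtype `H_θ` is zero. -/
noncomputable def hyperplaneMeasure {d : ℕ} (θ : EuclideanSpace ℝ (Fin d)) :
    Measure (hyperplane θ) :=
  (measureSpaceOfInnerProductSpace (E := hyperplane θ)).volume

/-- The orthogonal projection `P_θ(Ω) ⊆ H_θ` of `Ω`. -/
noncomputable def shadow {d : ℕ} (Ω : Set (EuclideanSpace ℝ (Fin d)))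
    (θ : EuclideanSpace ℝ (Fin d)) : Set (hyperplane θ) :=
  (hyperplane θ).orthogonalProjectionOnto '' Ω

/-- `ω_θ(y) = {s : s θ + y ∈ Ω}`. -/
def lineSection {d : ℕ} (Ω : Set (EuclideanSpace ℝ (Fin d))) (θ : EuclideanSpace ℝ (Fin d))
    (y : hyperplane θ) : Set ℝ :=
  {s : ℝ | s • θ + (y : EuclideanSpace ℝ (Fin d)) ∈ Ω}

/-- The pairs of endpoints `(α, β)` of the bounded open intervals `]α, β[` that are connected
components of the open set `U ⊆ ℝ`. -/
def componentIntervals (U : Set ℝ) : Set (ℝ × ℝ) :=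
  {p | p.1 < p.2 ∧ Ioo p.1 p.2 ⊆ U ∧ p.1 ∉ U ∧ p.2 ∉ U}

/-- `g : ∂Ω → ℝ` is a directional trace of `u` in the direction `θ`: for some representative `u'`
of `u` and `λ^{d-1}`-almost every `y ∈ P_θ(Ω)`, the function `s ↦ u' (s θ + y)` is in `H¹(ω_θ(y))`
and, for each component `]α, β[` of `ω_θ(y)`, it extends from `]α, β[` to a continuous function
`f` on `]α, β]` with `f β = g (β θ + y)`. -/
def IsDirectionalTrace {d : ℕ} (Ω : Set (EuclideanSpace ℝ (Fin d)))
    (θ : EuclideanSpace ℝ (Fin d)) (u : EuclideanSpace ℝ (Fin d) → ℝ)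
    (g : frontier Ω → ℝ) : Prop :=
  ∃ u' : EuclideanSpace ℝ (Fin d) → ℝ, u' =ᵐ[volume.restrict Ω] u ∧
    ∃ A : Set (hyperplane θ), A ⊆ shadow Ω θ ∧ hyperplaneMeasure θ (shadow Ω θ \ A) = 0 ∧
      ∀ y ∈ A,
        MemH1 (lineSection Ω θ y) (fun s => u' (s • θ + (y : EuclideanSpace ℝ (Fin d)))) ∧
        ∀ α β : ℝ, (α, β) ∈ componentIntervals (lineSection Ω θ y) →
          ∃ f : ℝ → ℝ, ContinuousOn f (Ioc α β) ∧
            (∀ s ∈ Ioo α β, f s = u' (s • θ + (y : EuclideanSpace ℝ (Fin d)))) ∧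
            ∃ h : β • θ + (y : EuclideanSpace ℝ (Fin d)) ∈ frontier Ω, g ⟨_, h⟩ = f β

/-! In the coordinates `(s, y) ↦ s θ + y`, Fubini turns the weak derivative along `θ` into weak
derivatives on almost every line (`ae_forall_integral_section_eq`). Each test function has its own
null set of lines; separability of spaces of continuous functions yields a single one. On an
interval, a function with integrable weak derivative agrees almost everywhere with one continuous up
to the ends (`HasWeakDirDeriv.exists_continuous_ae_eq`).

The crux is the measurability of `g`, which a choice made line by line would not give. Instead one
formula serves all points: `leftLimit`, the limsup of averages over short segments behind `x`,
applied to a Borel representative. It is Borel on the whole space, and on almost every line it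
equals the continuous version at each point of `]α, β]`, `β` included. Hence it is both the required
representative and, restricted to `∂Ω`, the trace. -/

/-! ### Weak derivatives on an interval. -/

/-- A smooth function with compact support in `]a, b[` and zero integral is the derivative of
a smooth function with compact support in `]a, b[`. -/
theorem exists_contDiff_primitive {a b : ℝ} {η : ℝ → ℝ} (hη : ContDiff ℝ ∞ η)
    (hc : HasCompactSupport η) (hs : tsupport η ⊆ Ioo a b) (h0 : ∫ s, η s = 0) :
    ∃ Ψ : ℝ → ℝ, ContDiff ℝ ∞ Ψ ∧ HasCompactSupport Ψ ∧ tsupport Ψ ⊆ Ioo a b ∧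
      deriv Ψ = η := by
  rcases (tsupport η).eq_empty_or_nonempty with he | hne
  · rw [tsupport_eq_empty_iff] at he
    refine ⟨0, contDiff_const, HasCompactSupport.zero, by simp [tsupport], ?_⟩
    subst he
    funext s
    simp
  have hK : IsCompact (tsupport η) := hc
  obtain ⟨c, hc1, hc2⟩ := hK.exists_isLeast hne
  obtain ⟨e, he1, he2⟩ := hK.exists_isGreatest hne
  have hzero : ∀ s, s ∉ Icc c e → η s = 0 := fun s hs' => by
    by_contra h
    have := subset_tsupport η (Function.mem_support.2 h)
    exact hs' ⟨hc2 this, he2 this⟩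
  have hcont := hη.continuous
  have hder : ∀ s, HasDerivAt (fun s => ∫ t in c..s, η t) (η s) s := fun s =>
    intervalIntegral.integral_hasDerivAt_right (hcont.intervalIntegrable _ _)
      (hcont.stronglyMeasurableAtFilter _ _) hcont.continuousAt
  have hd : deriv (fun s => ∫ t in c..s, η t) = η := funext fun s => (hder s).deriv
  have hce : c ≤ e := hc2 he1
  have htot : ∫ t in c..e, η t = 0 := by
    rw [intervalIntegral.integral_of_le hce, ← integral_Icc_eq_integral_Ioc, ← h0]
    exact setIntegral_eq_integral_of_forall_compl_eq_zero hzero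
  have hsup : tsupport (fun s => ∫ t in c..s, η t) ⊆ Icc c e := by
    refine closure_minimal (fun s hs' => ?_) isClosed_Icc
    by_contra hn
    apply hs'
    rw [mem_Icc, not_and_or, not_le, not_le] at hn
    rcases hn with hn | hn
    · refine (intervalIntegral.integral_congr_ae (g := fun _ => 0) ?_).trans (by simp)
      refine ae_of_all _ fun t ht => ?_
      rw [uIoc_of_ge hn.le] at ht
      -- The interval `]s, c]` contains `c` itself, where `η` vanishes by continuity from the left.
      by_cases h : t = c
      · subst h
        have hcl : t ∈ closure (Iio t) := by rw [closure_Iio]; exact mem_Iic.2 le_rfl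
        exact (isClosed_eq hcont continuous_const).closure_subset_iff.2
          (fun r hr => hzero r fun h => not_le.2 hr h.1) hcl
      · exact hzero t fun h' => h (le_antisymm ht.2 h'.1)
    · have : ∫ t in c..s, η t = (∫ t in c..e, η t) + ∫ t in e..s, η t :=
        (intervalIntegral.integral_add_adjacent_intervals (hcont.intervalIntegrable _ _)
          (hcont.intervalIntegrable _ _)).symm
      show ∫ t in c..s, η t = 0
      rw [this, htot, zero_add]
      refine (intervalIntegral.integral_congr_ae (g := fun _ => 0) ?_).trans (by simp)
      refine ae_of_all _ fun t ht => ?_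
      rw [uIoc_of_le hn.le] at ht
      exact hzero t fun h' => not_le.2 ht.1 h'.2
  refine ⟨_, ?_, HasCompactSupport.of_support_subset_isCompact isCompact_Icc
    ((subset_tsupport _).trans hsup), hsup.trans ?_, hd⟩
  · rw [contDiff_infty_iff_deriv, hd]
    exact ⟨fun s => (hder s).differentiableAt, hη⟩
  · exact fun s h => ⟨(hs hc1).1.trans_le h.1, h.2.trans_lt (hs he1).2⟩

/-- The **du Bois-Reymond lemma**: an integrable function on an interval whose weak derivative
vanishes is almost everywhere constant. -/
theorem exists_ae_eq_const_of_integral_mul_deriv_eq_zero {a b : ℝ} (hab : a < b) {w : ℝ → ℝ}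
    (hw : IntegrableOn w (Ioo a b))
    (h : ∀ φ : ℝ → ℝ, ContDiff ℝ ∞ φ → HasCompactSupport φ → tsupport φ ⊆ Ioo a b →
      ∫ s in Ioo a b, w s * deriv φ s = 0) :
    ∃ c : ℝ, ∀ᵐ s, s ∈ Ioo a b → w s = c := by
  let ρ : ContDiffBump ((a + b) / 2) := ⟨(b - a) / 8, (b - a) / 4, by linarith, by linarith⟩
  let r : ℝ → ℝ := ρ.normed volume
  have hr : ContDiff ℝ ∞ r := ρ.contDiff_normed
  have hrc : HasCompactSupport r := ρ.hasCompactSupport_normed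
  have hrs : tsupport r ⊆ Ioo a b := by
    rw [ρ.tsupport_normed_eq, Real.closedBall_eq_Icc]
    rintro s ⟨h1, h2⟩
    change (a + b) / 2 - (b - a) / 4 ≤ s at h1
    change s ≤ (a + b) / 2 + (b - a) / 4 at h2
    constructor <;> linarith
  have hr1 : ∫ s, r s = 1 := ρ.integral_normed
  set c := ∫ s in Ioo a b, w s * r s with hcdef
  refine ⟨c, ?_⟩
  have key : ∀ᵐ s, s ∈ Ioo a b → w s - c = 0 := by
    refine isOpen_Ioo.ae_eq_zero_of_integral_contDiff_smul_eq_zero ?_ ?_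
    · exact (hw.sub (integrableOn_const (by simp))).locallyIntegrableOn
    intro φ hφ hφc hφs
    let m := ∫ s, φ s
    have hφi : Integrable φ := hφ.continuous.integrable_of_hasCompactSupport hφc
    have hri : Integrable r := hr.continuous.integrable_of_hasCompactSupport hrc
    -- Since `r` has integral one, subtracting `m * r` makes the integral zero; pairing with `w`
    -- then leaves `∫ φ (w - c) = 0`.
    obtain ⟨Ψ, hΨ, hΨc, hΨs, hΨd⟩ := exists_contDiff_primitive (a := a) (b := b)
      (η := fun s => φ s - m * r s) (hφ.sub (contDiff_const.mul hr))
      (hφc.sub (hrc.mul_left (f := fun _ => m)))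
      ((tsupport_sub φ (fun s => m * r s)).trans (union_subset hφs
        ((tsupport_mul_subset_right (f := fun _ => m) (g := r)).trans hrs)))
      (by rw [integral_sub hφi (hri.const_mul m), integral_const_mul, hr1, mul_one, sub_self])
    have h1 := h Ψ hΨ hΨc hΨs
    rw [hΨd] at h1
    have hmul : ∀ {q : ℝ → ℝ}, ContDiff ℝ ∞ q → HasCompactSupport q →
        IntegrableOn (fun s => w s * q s) (Ioo a b) := fun {q} hq hqc => by
      obtain ⟨C, hC⟩ := hqc.exists_bound_of_continuous hq.continuous
      exact hw.mul_bdd hq.continuous.aestronglyMeasurable (ae_of_all _ hC)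
    have e1 : ∫ s in Ioo a b, w s * (φ s - m * r s) =
        (∫ s in Ioo a b, w s * φ s) - m * c := by
      rw [hcdef, ← integral_const_mul, ← integral_sub (hmul hφ hφc) ((hmul hr hrc).const_mul m)]
      congr 1; funext s; ring
    have e2 : ∫ s in Ioo a b, φ s = m :=
      setIntegral_eq_integral_of_forall_compl_eq_zero fun s hs => by
        by_contra h'
        exact hs (hφs (subset_tsupport φ h'))
    have e3 : ∫ s, φ s • (w s - c) = ∫ s in Ioo a b, φ s • (w s - c) :=
      (setIntegral_eq_integral_of_forall_compl_eq_zero fun s hs => by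
        by_contra h'
        exact hs (hφs (subset_tsupport φ (left_ne_zero_of_smul h')))).symm
    rw [e3]
    have e4 : ∫ s in Ioo a b, φ s • (w s - c) =
        (∫ s in Ioo a b, w s * φ s) - c * ∫ s in Ioo a b, φ s := by
      rw [← integral_const_mul, ← integral_sub (hmul hφ hφc) (hφi.integrableOn.const_mul c)]
      congr 1; funext s; simp only [smul_eq_mul]; ring
    rw [e4, e2]
    rw [e1] at h1
    linarith
  filter_upwards [key] with s hs h'
  exact sub_eq_zero.1 (hs h')

/-- On a bounded interval, an integrable function with an integrable weak derivative agrees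
almost everywhere with a function that is continuous up to the endpoints. -/
theorem HasWeakDirDeriv.exists_continuous_ae_eq {a b : ℝ} (hab : a < b) {f v : ℝ → ℝ}
    (hf : IntegrableOn f (Ioo a b)) (hv : IntegrableOn v (Ioo a b))
    (h : HasWeakDirDeriv (Ioo a b) (1 : ℝ) f v) :
    ∃ F : ℝ → ℝ, Continuous F ∧ ∀ᵐ s, s ∈ Ioo a b → f s = F s := by
  let v' : ℝ → ℝ := (Ioo a b).indicator v
  have hv' : Integrable v' := hv.integrable_indicator measurableSet_Ioo
  let V : ℝ → ℝ := fun s => ∫ t in a..s, v' t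
  have hVc : Continuous V :=
    intervalIntegral.continuous_primitive (fun _ _ => hv'.intervalIntegrable) a
  -- Absolute continuity of `V` is enough to integrate by parts, so `f - V` has zero weak
  -- derivative.
  have hVac : AbsolutelyContinuousOnInterval V a b :=
    (hv'.intervalIntegrable (a := a) (b := b)).absolutelyContinuousOnInterval_intervalIntegral
      left_mem_uIcc
  have hVi : IntegrableOn V (Ioo a b) :=
    (hVc.integrableOn_Icc (a := a) (b := b)).mono_set Ioo_subset_Icc_self
  have hVd : ∀ᵐ s, s ∈ Ioo a b → deriv V s = v s := by
    filter_upwards [LocallyIntegrable.ae_hasDerivAt_integral hv'.locallyIntegrable] with s hs hsI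
    rw [(hs a).deriv]
    exact indicator_of_mem hsI v
  obtain ⟨c, hc⟩ := exists_ae_eq_const_of_integral_mul_deriv_eq_zero hab (hf.sub hVi) (by
    intro φ hφ hφc hφs
    have hz : ∀ s, s ∉ Ioo a b → φ s = 0 := fun s hs => by
      by_contra h'
      exact hs (hφs (subset_tsupport φ h'))
    have hφ1 : ContDiff ℝ 1 φ := hφ.of_le (by norm_cast)
    have hφac : AbsolutelyContinuousOnInterval φ a b :=
      hφ1.contDiffOn.absolutelyContinuousOnInterval
    have ibp := hVac.integral_mul_deriv_eq_deriv_mul hφac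
    rw [hz a (by simp), hz b (by simp), mul_zero, mul_zero, sub_zero, zero_sub,
      intervalIntegral.integral_of_le hab.le, intervalIntegral.integral_of_le hab.le,
      integral_Ioc_eq_integral_Ioo, integral_Ioc_eq_integral_Ioo] at ibp
    have e1 : ∫ s in Ioo a b, deriv V s * φ s = ∫ s in Ioo a b, v s * φ s := by
      refine setIntegral_congr_ae measurableSet_Ioo ?_
      filter_upwards [hVd] with s hs hsI
      rw [hs hsI]
    have hw := h φ hφ hφc hφs
    simp only [fderiv_eq_smul_deriv, one_smul] at hw
    obtain ⟨C, hC⟩ := hφc.deriv.exists_bound_of_continuous (hφ1.continuous_deriv le_rfl)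
    have hm := (hφ1.continuous_deriv le_rfl).aestronglyMeasurable
      (μ := volume.restrict (Ioo a b))
    have : ∫ s in Ioo a b, (f - V) s * deriv φ s =
        (∫ s in Ioo a b, f s * deriv φ s) - ∫ s in Ioo a b, V s * deriv φ s := by
      rw [← integral_sub (hf.mul_bdd hm (ae_of_all _ hC)) (hVi.mul_bdd hm (ae_of_all _ hC))]
      congr 1; funext s; simp only [Pi.sub_apply]; ring
    rw [this, hw, ibp, e1, sub_self])
  refine ⟨fun s => V s + c, hVc.add continuous_const, ?_⟩
  filter_upwards [hc] with s hs hsI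
  have := hs hsI
  simp only [Pi.sub_apply] at this
  linarith

/-- The left averages of a function that agrees almost everywhere with a continuous function
on the left of `s` converge to the value of the latter at `s`. -/
theorem tendsto_left_average {a b : ℝ} {f F : ℝ → ℝ} (hF : Continuous F)
    (h : ∀ᵐ s, s ∈ Ioo a b → f s = F s) {s : ℝ} (hs : s ∈ Ioc a b) :
    Tendsto (fun n : ℕ => ((n : ℝ) + 1) * ∫ t in Ioo 0 (1 / ((n : ℝ) + 1)), f (s - t)) atTop
      (𝓝 (F s)) := by
  -- The averages of `F` are the difference quotients at `0` of this primitive.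
  have hder : HasDerivAt (fun r => ∫ t in 0..r, F (s - t)) (F (s - 0)) 0 := by
    have hc : Continuous fun t => F (s - t) := by fun_prop
    exact intervalIntegral.integral_hasDerivAt_right (hc.intervalIntegrable _ _)
      (hc.stronglyMeasurableAtFilter _ _) hc.continuousAt
  rw [sub_zero, hasDerivAt_iff_tendsto_slope] at hder
  have hseq : Tendsto (fun n : ℕ => 1 / ((n : ℝ) + 1)) atTop (𝓝[≠] 0) :=
    tendsto_nhdsWithin_iff.2 ⟨tendsto_one_div_add_atTop_nhds_zero_nat,
      Eventually.of_forall fun n => by simp; positivity⟩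
  refine (hder.comp hseq).congr' ?_
  have hev : ∀ᶠ n : ℕ in atTop, 1 / ((n : ℝ) + 1) < s - a :=
    tendsto_one_div_add_atTop_nhds_zero_nat.eventually (gt_mem_nhds (sub_pos.2 hs.1))
  filter_upwards [hev] with n hn
  have hpos : (0 : ℝ) < 1 / ((n : ℝ) + 1) := by positivity
  simp only [Function.comp, slope, vsub_eq_sub, sub_zero, intervalIntegral.integral_same,
    smul_eq_mul]
  rw [one_div, inv_inv, ← one_div, intervalIntegral.integral_of_le hpos.le,
    integral_Ioc_eq_integral_Ioo]
  congr 1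
  refine setIntegral_congr_ae measurableSet_Ioo ?_
  have := (volume.measurePreserving_sub_left s).quasiMeasurePreserving.ae h
  filter_upwards [this] with t ht htI
  exact (ht ⟨by linarith [htI.2], by linarith [htI.1, hs.2]⟩).symm

/-- Integration against an integrable function vanishing off a compact set is continuous for
the compact-open topology. -/
theorem continuous_integral_mul_continuousMap {f : ℝ → ℝ} (hf : Integrable f) {K : Set ℝ}
    (hK : IsCompact K) (h0 : ∀ s, s ∉ K → f s = 0) :
    Continuous fun q : C(ℝ, ℝ) => ∫ s, f s * q s := by
  have hint : ∀ q : C(ℝ, ℝ), Integrable fun s => f s * q s := fun q => by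
    have h1 : IntegrableOn (fun s => f s * q s) K :=
      hf.integrableOn.mul_continuousOn q.continuous.continuousOn hK
    exact (integrableOn_iff_integrable_of_support_subset fun s hs => by
      by_contra h
      exact hs (by simp [h0 s h])).1 h1
  rw [continuous_iff_continuousAt]
  intro q
  rw [ContinuousAt, Metric.tendsto_nhds]
  intro ε hε
  set M := ∫ s, ‖f s‖
  have hM : 0 ≤ M := integral_nonneg fun _ => norm_nonneg _
  have hδ : 0 < ε / (M + 1) := by positivity
  have hunif := ContinuousMap.tendsto_iff_forall_isCompact_tendstoUniformlyOn.1
    (tendsto_id (x := 𝓝 q)) K hK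
  filter_upwards [Metric.tendstoUniformlyOn_iff.1 hunif _ hδ] with p hp
  rw [dist_eq_norm, ← integral_sub (hint p) (hint q)]
  calc ‖∫ s, (f s * p s - f s * q s)‖ ≤ ∫ s, ε / (M + 1) * ‖f s‖ := by
        refine norm_integral_le_of_norm_le (hf.norm.const_mul _) (ae_of_all _ fun s => ?_)
        by_cases hs : s ∈ K
        · rw [← mul_sub, norm_mul, mul_comm]
          refine mul_le_mul_of_nonneg_right ?_ (norm_nonneg _)
          have := (hp s hs).le
          rwa [dist_comm, dist_eq_norm] at this
        · simp [h0 s hs]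
    _ = ε / (M + 1) * M := integral_const_mul _ _
    _ < ε := by
        rw [div_mul_eq_mul_div, div_lt_iff₀ (by positivity)]
        nlinarith

/-! ### Sections of weak derivatives on a product. -/

section Sections

variable {H : Type*} [NormedAddCommGroup H] [NormedSpace ℝ H] [FiniteDimensional ℝ H]
  [MeasurableSpace H] [BorelSpace H] {μ : Measure H}
  {U : Set (ℝ × H)} {u v : ℝ × H → ℝ}

theorem integrable_mul_prod_of_continuous (hu : Integrable u (volume.prod μ)) {η : ℝ → ℝ}
    {ψ : H → ℝ} (hη : Continuous η) (hηc : HasCompactSupport η) (hψ : Continuous ψ)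
    (hψc : HasCompactSupport ψ) :
    Integrable (fun p : ℝ × H => u p * (η p.1 * ψ p.2)) (volume.prod μ) := by
  obtain ⟨C, hC⟩ := hηc.exists_bound_of_continuous hη
  obtain ⟨D, hD⟩ := hψc.exists_bound_of_continuous hψ
  refine hu.mul_bdd (c := C * D) (by fun_prop) (ae_of_all _ fun p => ?_)
  rw [norm_mul]
  exact mul_le_mul (hC _) (hD _) (norm_nonneg _) ((norm_nonneg _).trans (hC p.1))

/-- A product test function `η(s) ψ(y)` detects the weak derivative of almost every section,
for a fixed `η`. -/
theorem ae_integral_section_eq_zero [SigmaFinite μ] (hu : Integrable u (volume.prod μ))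
    (hv : Integrable v (volume.prod μ)) {η : ℝ → ℝ} (hη : ContDiff ℝ ∞ η)
    (hηc : HasCompactSupport η) {B : Set H} (hB : IsOpen B)
    (h : ∀ ψ : H → ℝ, ContDiff ℝ ∞ ψ → HasCompactSupport ψ → tsupport ψ ⊆ B →
      ∫ p, u p * (deriv η p.1 * ψ p.2) ∂(volume.prod μ) =
        - ∫ p, v p * (η p.1 * ψ p.2) ∂(volume.prod μ)) :
    ∀ᵐ y ∂μ, y ∈ B → (∫ s, u (s, y) * deriv η s) + ∫ s, v (s, y) * η s = 0 := by
  have hη' : Continuous (deriv η) := (hη.of_le (by norm_cast) : ContDiff ℝ 1 η).continuous_deriv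
    le_rfl
  obtain ⟨C, hC⟩ := hηc.exists_bound_of_continuous hη.continuous
  obtain ⟨C', hC'⟩ := hηc.deriv.exists_bound_of_continuous hη'
  have h1 : Integrable (fun p : ℝ × H => u p * deriv η p.1) (volume.prod μ) :=
    hu.mul_bdd (by fun_prop) (ae_of_all _ fun p => hC' p.1)
  have h2 : Integrable (fun p : ℝ × H => v p * η p.1) (volume.prod μ) :=
    hv.mul_bdd (hη.continuous.comp continuous_fst).aestronglyMeasurable
      (ae_of_all _ fun p => hC p.1)
  refine hB.ae_eq_zero_of_integral_contDiff_smul_eq_zero ?_ ?_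
  · exact (h1.integral_prod_right.add h2.integral_prod_right).integrableOn.locallyIntegrableOn
  intro ψ hψ hψc hψs
  have e := h ψ hψ hψc hψs
  have i1 := integrable_mul_prod_of_continuous hu hη' hηc.deriv hψ.continuous hψc
  have i2 := integrable_mul_prod_of_continuous hv hη.continuous hηc hψ.continuous hψc
  rw [integral_prod_symm _ i1, integral_prod_symm _ i2, ← sub_eq_zero, sub_neg_eq_add,
    ← integral_add i1.integral_prod_right i2.integral_prod_right] at e
  rw [← e]
  congr 1
  funext y
  simp only [smul_eq_mul, mul_add, ← integral_const_mul]
  congr 2 <;> · funext s; ring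

/-- If the weak derivative in the first variable of `u` is `v` on `U`, tested on products, then
almost every section of `v` is the weak derivative of the section of `u`. -/
theorem ae_forall_integral_section_eq [SigmaFinite μ] (hU : IsOpen U) {K : Set ℝ}
    (hK : IsCompact K) (hu : Integrable u (volume.prod μ)) (hv : Integrable v (volume.prod μ))
    (hu0 : ∀ p : ℝ × H, p.1 ∉ K → u p = 0) (hv0 : ∀ p : ℝ × H, p.1 ∉ K → v p = 0)
    (h : ∀ (η : ℝ → ℝ) (ψ : H → ℝ), ContDiff ℝ ∞ η → HasCompactSupport η → ContDiff ℝ ∞ ψ →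
      HasCompactSupport ψ → tsupport η ×ˢ tsupport ψ ⊆ U →
      ∫ p, u p * (deriv η p.1 * ψ p.2) ∂(volume.prod μ) =
        - ∫ p, v p * (η p.1 * ψ p.2) ∂(volume.prod μ)) :
    ∀ᵐ y ∂μ, ∀ η : ℝ → ℝ, ContDiff ℝ ∞ η → HasCompactSupport η →
      (∀ s ∈ tsupport η, (s, y) ∈ U) →
        ∫ s, u (s, y) * deriv η s = - ∫ s, v (s, y) * η s := by
  have : ProperSpace H := FiniteDimensional.proper ℝ H
  -- Recording `deriv η` as a second component makes the pairings continuous for the compact-open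
  -- topology, in which `S B` is separable. The last condition admits every `ψ` supported in `B`.
  let S : Set H → Set (C(ℝ, ℝ) × C(ℝ, ℝ)) := fun B =>
    {p | ContDiff ℝ ∞ p.1 ∧ HasCompactSupport p.1 ∧ (p.2 : ℝ → ℝ) = deriv p.1 ∧
      tsupport p.1 ×ˢ B ⊆ U}
  have hbasis := TopologicalSpace.isBasis_countableBasis H
  have main : ∀ B ∈ TopologicalSpace.countableBasis H, ∀ᵐ y ∂μ, y ∈ B → ∀ p ∈ S B,
      (∫ s, u (s, y) * p.2 s) + ∫ s, v (s, y) * p.1 s = 0 := by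
    intro B hB
    obtain ⟨D, hDc, hDd⟩ := TopologicalSpace.exists_countable_dense (S B)
    have hD : ∀ᵐ y ∂μ, ∀ p ∈ D, y ∈ B →
        (∫ s, u (s, y) * p.1.2 s) + ∫ s, v (s, y) * p.1.1 s = 0 := by
      rw [ae_ball_iff hDc]
      rintro ⟨p, hp1, hp2, hp3, hp4⟩ -
      simp only [hp3]
      exact ae_integral_section_eq_zero hu hv hp1 hp2 (hbasis.isOpen hB)
        fun ψ hψ hψc hψs => h _ ψ hp1 hp2 hψ hψc ((prod_mono_right hψs).trans hp4)
    filter_upwards [hD, hu.prod_left_ae, hv.prod_left_ae] with y hy huy hvy hyB p hp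
    have c1 := continuous_integral_mul_continuousMap huy hK fun s hs => hu0 (s, y) hs
    have c2 := continuous_integral_mul_continuousMap hvy hK fun s hs => hv0 (s, y) hs
    have hcont : Continuous fun p : S B =>
        (∫ s, u (s, y) * p.1.2 s) + ∫ s, v (s, y) * p.1.1 s :=
      (c1.comp (continuous_snd.comp continuous_subtype_val)).add
        (c2.comp (continuous_fst.comp continuous_subtype_val))
    exact congrFun (Continuous.ext_on hDd hcont continuous_const
      (g := fun _ => (0 : ℝ)) fun p hp => hy p hp hyB) ⟨p, hp⟩
  have main' := (ae_ball_iff (TopologicalSpace.countable_countableBasis H)).2 main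
  filter_upwards [main'] with y hy η hη hηc hs
  -- The tube lemma places `η` in `S B` for a basic neighbourhood `B` of `y`, so countably many `B`
  -- suffice.
  obtain ⟨O, W, -, hW, hO, hyW, hOW⟩ := generalized_tube_lemma (t := {y}) (n := U)
    (hηc : IsCompact (tsupport η)) isCompact_singleton hU
    (by rintro ⟨s, z⟩ ⟨h1, rfl⟩; exact hs s h1)
  obtain ⟨B, hB, hyB, hBW⟩ := hbasis.exists_subset_of_mem_open (hyW rfl) hW
  have hη' : Continuous (deriv η) := (hη.of_le (by norm_cast) : ContDiff ℝ 1 η).continuous_deriv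
    le_rfl
  have := hy B hB hyB (⟨η, hη.continuous⟩, ⟨deriv η, hη'⟩)
    ⟨hη, hηc, rfl, (prod_mono hO hBW).trans hOW⟩
  exact eq_neg_of_add_eq_zero_left this

end Sections

theorem setIntegral_mul_eq_integral_of_tsupport_subset {E : Type*} [TopologicalSpace E]
    [MeasurableSpace E] {μ : Measure E} {I : Set E} {f φ : E → ℝ} (h : tsupport φ ⊆ I) :
    ∫ x in I, f x * φ x ∂μ = ∫ x, f x * φ x ∂μ :=
  setIntegral_eq_integral_of_forall_compl_eq_zero fun x hx => by
    rw [image_eq_zero_of_notMem_tsupport fun h' => hx (h h'), mul_zero]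

/-- The weak derivative on a subset of the line, from the identity for integrals over the line. -/
theorem hasWeakDirDeriv_of_integral_eq {I : Set ℝ} {f v : ℝ → ℝ}
    (h : ∀ η : ℝ → ℝ, ContDiff ℝ ∞ η → HasCompactSupport η → tsupport η ⊆ I →
      ∫ s, f s * deriv η s = - ∫ s, v s * η s) : HasWeakDirDeriv I (1 : ℝ) f v := by
  intro φ hφ hφc hφs
  simp only [fderiv_eq_smul_deriv, one_smul]
  rw [setIntegral_mul_eq_integral_of_tsupport_subset hφs,
    setIntegral_mul_eq_integral_of_tsupport_subset (tsupport_deriv_subset.trans hφs)]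
  exact h φ hφ hφc hφs

theorem HasWeakDirDeriv.congr_ae {E : Type*} [NormedAddCommGroup E] [NormedSpace ℝ E]
    [MeasureSpace E] {Ω : Set E} {θ : E} {u u' v v' : E → ℝ} (h : HasWeakDirDeriv Ω θ u v)
    (hu : u' =ᵐ[volume.restrict Ω] u) (hv : v' =ᵐ[volume.restrict Ω] v) :
    HasWeakDirDeriv Ω θ u' v' := by
  intro φ hφ hφc hφs
  calc ∫ x in Ω, u' x * fderiv ℝ φ x θ = ∫ x in Ω, u x * fderiv ℝ φ x θ :=
        integral_congr_ae (hu.mul (ae_eq_refl fun x => fderiv ℝ φ x θ))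
    _ = - ∫ x in Ω, v x * φ x := h φ hφ hφc hφs
    _ = - ∫ x in Ω, v' x * φ x :=
        congrArg Neg.neg (integral_congr_ae (hv.symm.mul (ae_eq_refl φ)))

/-! ### The Borel representative given by left averages. -/

section Lines

variable {E H : Type*} [NormedAddCommGroup E] [NormedSpace ℝ E]
  [NormedAddCommGroup H] [NormedSpace ℝ H]

/-- The upper limit of the averages of `u` over the segments `[x - θ / (n + 1), x]`. -/
noncomputable def leftLimit (θ : E) (u : E → ℝ) (x : E) : ℝ :=
  limsup (fun n : ℕ => ((n : ℝ) + 1) * ∫ t in Ioo 0 (1 / ((n : ℝ) + 1)), u (x - t • θ)) atTop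

/-- Parameter integrals and countable limsups preserve measurability; convergence of the averages
plays no role. -/
theorem measurable_leftLimit [MeasurableSpace E] [BorelSpace E]
    [SecondCountableTopology E] (θ : E) {u : E → ℝ} (hu : Measurable u) :
    Measurable (leftLimit θ u) := by
  refine Measurable.limsup fun n => Measurable.const_mul ?_ _
  have : StronglyMeasurable fun p : E × ℝ => u (p.1 - p.2 • θ) :=
    (hu.comp (by fun_prop)).stronglyMeasurable
  exact this.integral_prod_right.measurable

/-- For large `n` the averages only see points of `]a, b[`, even when `s = b`; this is how boundary
values are reached. -/
theorem leftLimit_eq {Φ : (ℝ × H) →L[ℝ] E} {u : E → ℝ} {F : ℝ → ℝ} {a b : ℝ} {y : H}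
    (hF : Continuous F) (h : ∀ᵐ s, s ∈ Ioo a b → u (Φ (s, y)) = F s) {s : ℝ} (hs : s ∈ Ioc a b) :
    leftLimit (Φ (1, 0)) u (Φ (s, y)) = F s := by
  rw [← (tendsto_left_average hF h hs).limsup_eq]
  have : ∀ t : ℝ, Φ (s, y) - t • Φ (1, 0) = Φ (s - t, y) := fun t => by
    rw [← map_smul, ← map_sub]
    simp
  simp only [leftLimit, this]

variable [MeasureSpace E] [BorelSpace E] [MeasurableSpace H] [BorelSpace H]

/-- The weak derivative along `Φ (1, 0)`, tested on a product in the coordinates of `Φ`. -/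
theorem HasWeakDirDeriv.integral_prod_test {Φ : (ℝ × H) ≃L[ℝ] E} {μ : Measure H}
    (hΦ : MeasurePreserving Φ (volume.prod μ) volume) {Ω : Set E} {u v : E → ℝ}
    (h : HasWeakDirDeriv Ω (Φ (1, 0)) u v) {η : ℝ → ℝ} {ψ : H → ℝ} (hη : ContDiff ℝ ∞ η)
    (hηc : HasCompactSupport η) (hψ : ContDiff ℝ ∞ ψ) (hψc : HasCompactSupport ψ)
    (hs : tsupport η ×ˢ tsupport ψ ⊆ Φ ⁻¹' Ω) :
    ∫ p, u (Φ p) * (deriv η p.1 * ψ p.2) ∂(volume.prod μ) =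
      - ∫ p, v (Φ p) * (η p.1 * ψ p.2) ∂(volume.prod μ) := by
  let φ : E → ℝ := fun x => η (Φ.symm x).1 * ψ (Φ.symm x).2
  have hφ : ContDiff ℝ ∞ φ :=
    (hη.comp (contDiff_fst.comp Φ.symm.contDiff)).mul
      (hψ.comp (contDiff_snd.comp Φ.symm.contDiff))
  have hsub : tsupport φ ⊆ Φ '' (tsupport η ×ˢ tsupport ψ) := by
    refine closure_minimal (fun x hx => ⟨Φ.symm x, ⟨subset_tsupport _ ?_, subset_tsupport _ ?_⟩,
      by simp⟩) ?_
    · exact left_ne_zero_of_mul hx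
    · exact right_ne_zero_of_mul hx
    · exact Φ.toHomeomorph.isClosedMap _ ((isClosed_tsupport η).prod (isClosed_tsupport ψ))
  have hφc : HasCompactSupport φ :=
    ((hηc.isCompact.prod hψc.isCompact).image Φ.continuous).of_isClosed_subset
      (isClosed_tsupport φ) hsub
  have hφs : tsupport φ ⊆ Ω := hsub.trans (image_subset_iff.2 hs)
  have hder : ∀ p : ℝ × H, fderiv ℝ φ (Φ p) (Φ (1, 0)) = deriv η p.1 * ψ p.2 := by
    intro p
    have h1 : HasDerivAt (fun t : ℝ => Φ p + t • Φ (1, 0)) (Φ (1, 0)) 0 := by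
      simpa using ((hasDerivAt_id (0 : ℝ)).smul_const (Φ (1, 0))).const_add (Φ p)
    have h2 : HasFDerivAt φ (fderiv ℝ φ (Φ p)) (Φ p + (0 : ℝ) • Φ (1, 0)) := by
      rw [zero_smul, add_zero]
      exact (hφ.differentiable (by simp) _).hasFDerivAt
    have h3 := h2.comp_hasDerivAt (0 : ℝ) h1
    have h4 : HasDerivAt (fun t : ℝ => η (p.1 + t) * ψ p.2) (deriv η p.1 * ψ p.2) 0 := by
      have h5 : HasDerivAt η (deriv η p.1) (p.1 + 0) := by
        rw [add_zero]; exact (hη.differentiable (by simp) _).hasDerivAt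
      have h6 := h5.comp_const_add p.1 0
      exact h6.mul_const _
    refine h3.unique (h4.congr_of_eventuallyEq (Eventually.of_forall fun t => ?_))
    simp [φ]
  have e := h φ hφ hφc hφs
  rw [setIntegral_mul_eq_integral_of_tsupport_subset hφs,
    setIntegral_mul_eq_integral_of_tsupport_subset
      ((tsupport_fderiv_apply_subset ℝ (Φ (1, 0))).trans hφs),
    ← hΦ.integral_comp Φ.toHomeomorph.measurableEmbedding,
    ← hΦ.integral_comp Φ.toHomeomorph.measurableEmbedding] at e
  simpa only [hder, φ, ContinuousLinearEquiv.symm_apply_apply] using e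

/-- Sections of a function with a weak derivative along the lines `Φ (·, y)`: a representative is,
on almost every line, in `H¹` and continuous from the left up to the ends of the components. -/
theorem exists_measurable_representative [FiniteDimensional ℝ E] [FiniteDimensional ℝ H]
    [IsFiniteMeasureOnCompacts (volume : Measure E)]
    {Φ : (ℝ × H) ≃L[ℝ] E} {μ : Measure H} [SigmaFinite μ]
    (hΦ : MeasurePreserving Φ (volume.prod μ) volume) {Ω : Set E} (hΩ : IsOpen Ω)
    (hΩb : Bornology.IsBounded Ω) {u : E → ℝ} (hu : MemW Ω (Φ (1, 0)) u) :
    ∃ G : E → ℝ, Measurable G ∧ G =ᵐ[volume.restrict Ω] u ∧ ∀ᵐ y ∂μ,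
      MemH1 {s : ℝ | Φ (s, y) ∈ Ω} (fun s => G (Φ (s, y))) ∧
      ∀ a b : ℝ, a < b → Ioo a b ⊆ {s : ℝ | Φ (s, y) ∈ Ω} →
        ContinuousOn (fun s => G (Φ (s, y))) (Ioc a b) := by
  have : ProperSpace E := FiniteDimensional.proper ℝ E
  have : ProperSpace H := FiniteDimensional.proper ℝ H
  obtain ⟨hu2, v, hv2, hw⟩ := hu
  have rep : ∀ f : E → ℝ, MemLp f 2 (volume.restrict Ω) → ∃ f' : E → ℝ, Measurable f' ∧
      f' =ᵐ[volume.restrict Ω] f ∧ MemLp f' 2 volume ∧ Integrable f' ∧ ∀ x ∉ Ω, f' x = 0 := by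
    intro f hf
    have hfm := hf.aestronglyMeasurable
    refine ⟨Ω.indicator (hfm.mk f), hfm.stronglyMeasurable_mk.measurable.indicator
      hΩ.measurableSet, ?_, ?_, ?_, fun x hx => indicator_of_notMem hx _⟩
    · exact (indicator_ae_eq_restrict hΩ.measurableSet).trans hfm.ae_eq_mk.symm
    · rw [memLp_indicator_iff_restrict hΩ.measurableSet]
      exact hf.ae_eq hfm.ae_eq_mk
    · have : IsFiniteMeasure (volume.restrict Ω) :=
        isFiniteMeasure_restrict.2 hΩb.measure_lt_top.ne
      rw [integrable_indicator_iff hΩ.measurableSet]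
      exact (hf.integrable (by norm_num)).congr hfm.ae_eq_mk
  obtain ⟨u', hum, hue, hu2', hui, hu0⟩ := rep u hu2
  obtain ⟨v', hvm, hve, hv2', hvi, hv0⟩ := rep v hv2
  have hw' := hw.congr_ae hue hve
  -- Boundedness of `Ω` gives one compact set outside which all sections vanish.
  let K : Set ℝ := (fun x => (Φ.symm x).1) '' closure Ω
  have hK : IsCompact K := hΩb.isCompact_closure.image (by fun_prop)
  have hKn : ∀ p : ℝ × H, p.1 ∉ K → Φ p ∉ Ω := fun p hp h' =>
    hp ⟨Φ p, subset_closure h', by simp⟩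
  have hsec := ae_forall_integral_section_eq (μ := μ) (U := Φ ⁻¹' Ω)
    (u := fun p => u' (Φ p)) (v := fun p => v' (Φ p)) (hΩ.preimage Φ.continuous) hK
    (hΦ.integrable_comp_of_integrable hui) (hΦ.integrable_comp_of_integrable hvi)
    (fun p hp => hu0 _ (hKn p hp)) (fun p hp => hv0 _ (hKn p hp))
    (fun η ψ hη hηc hψ hψc hs => HasWeakDirDeriv.integral_prod_test hΦ hw' hη hηc hψ hψc hs)
  have hL2 : ∀ f : E → ℝ, Measurable f → MemLp f 2 volume →
      ∀ᵐ y ∂μ, MemLp (fun s => f (Φ (s, y))) 2 volume := by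
    intro f hfm hf
    have := hΦ.integrable_comp_of_integrable hf.integrable_sq
    filter_upwards [this.prod_left_ae] with y hy
    refine (memLp_two_iff_integrable_sq ?_).2 hy
    exact (hfm.comp (Φ.continuous.measurable.comp (by fun_prop))).aestronglyMeasurable
  have hL1 : ∀ f : E → ℝ, Integrable f → ∀ᵐ y ∂μ, Integrable (fun s => f (Φ (s, y))) :=
    fun f hf => (hΦ.integrable_comp_of_integrable hf).prod_left_ae
  have hGm := measurable_leftLimit (Φ (1, 0)) hum
  have hgood : ∀ᵐ y ∂μ, (∀ᵐ s : ℝ, Φ (s, y) ∈ Ω →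
        leftLimit (Φ (1, 0)) u' (Φ (s, y)) = u' (Φ (s, y))) ∧
      MemH1 {s : ℝ | Φ (s, y) ∈ Ω} (fun s => leftLimit (Φ (1, 0)) u' (Φ (s, y))) ∧
      ∀ a b : ℝ, a < b → Ioo a b ⊆ {s : ℝ | Φ (s, y) ∈ Ω} →
        ContinuousOn (fun s => leftLimit (Φ (1, 0)) u' (Φ (s, y))) (Ioc a b) := by
    filter_upwards [hsec, hL2 u' hum hu2', hL2 v' hvm hv2', hL1 u' hui, hL1 v' hvi]
      with y hy hu2y hv2y huy hvy
    have hcont : ∀ a b : ℝ, a < b → Ioo a b ⊆ {s : ℝ | Φ (s, y) ∈ Ω} → ∃ F : ℝ → ℝ,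
        Continuous F ∧ (∀ᵐ s, s ∈ Ioo a b → u' (Φ (s, y)) = F s) ∧
        ∀ s ∈ Ioc a b, leftLimit (Φ (1, 0)) u' (Φ (s, y)) = F s := by
      intro a b hab hI
      obtain ⟨F, hF, hFe⟩ := HasWeakDirDeriv.exists_continuous_ae_eq hab huy.integrableOn
        hvy.integrableOn (hasWeakDirDeriv_of_integral_eq fun η hη hηc hηs =>
          hy η hη hηc (hηs.trans hI))
      exact ⟨F, hF, hFe, fun s hs =>
        leftLimit_eq (Φ := (Φ : (ℝ × H) →L[ℝ] E)) hF hFe hs⟩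
    have hopen : IsOpen {s : ℝ | Φ (s, y) ∈ Ω} := hΩ.preimage (by fun_prop)
    have hae : ∀ᵐ s : ℝ, Φ (s, y) ∈ Ω →
        leftLimit (Φ (1, 0)) u' (Φ (s, y)) = u' (Φ (s, y)) := by
      rw [ae_iff]
      -- The continuous version is available only interval by interval, so the exceptional set is
      -- shown to be null locally.
      refine measure_null_of_locally_null _ fun s hs => ?_
      have hsω : Φ (s, y) ∈ Ω := by
        by_contra h'
        exact hs fun h'' => absurd h'' h'
      obtain ⟨a, b, ⟨h1, h2⟩, hab⟩ :=
        (mem_nhds_iff_exists_Ioo_subset.1 (hopen.mem_nhds hsω))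
      obtain ⟨F, -, hFe, hFl⟩ := hcont a b (h1.trans h2) hab
      refine ⟨_, inter_mem_nhdsWithin _ (Ioo_mem_nhds h1 h2), ?_⟩
      refine measure_mono_null ?_ (ae_iff.1 hFe)
      rintro r ⟨hr1, hr2⟩ hr3
      exact hr1 fun _ => (hFl r ⟨hr2.1, hr2.2.le⟩).trans (hr3 hr2).symm
    have haer : (fun s => leftLimit (Φ (1, 0)) u' (Φ (s, y)))
        =ᵐ[volume.restrict {s : ℝ | Φ (s, y) ∈ Ω}] fun s => u' (Φ (s, y)) :=
      (ae_restrict_iff' hopen.measurableSet).2 hae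
    refine ⟨hae, ⟨(hu2y.restrict _).ae_eq haer.symm, fun s => v' (Φ (s, y)), hv2y.restrict _,
      (hasWeakDirDeriv_of_integral_eq hy).congr_ae haer (ae_eq_refl _)⟩, fun a b hab hI => ?_⟩
    obtain ⟨F, hF, -, hFl⟩ := hcont a b hab hI
    exact hF.continuousOn.congr hFl
  refine ⟨leftLimit (Φ (1, 0)) u', hGm, EventuallyEq.trans ?_ hue, hgood.mono fun y hy => hy.2⟩
  -- Fubini passes from lines to `Ω` once the exceptional set is known to be Borel.
  have hms : MeasurableSet {x | ¬ (x ∈ Ω → leftLimit (Φ (1, 0)) u' x = u' x)} := by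
    simp only [Classical.not_imp]
    exact hΩ.measurableSet.inter (measurableSet_eq_fun hGm hum).compl
  rw [EventuallyEq, ae_restrict_iff' hΩ.measurableSet, ae_iff, ← hΦ.measure_preimage
    hms.nullMeasurableSet, Measure.prod_apply_symm (Φ.continuous.measurable hms)]
  refine (lintegral_congr_ae (g := fun _ => 0) ?_).trans (by simp)
  filter_upwards [hgood] with y hy
  exact ae_iff.1 hy.1

end Lines

/-! ### The orthogonal splitting along `θ`. -/

section Hyperplane

variable {d : ℕ}

/-- Keeping `H` abstract makes its `volume` the Euclidean one; on a subtype it could be read as a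
restricted measure. -/
theorem measurePreserving_prod_of_linearIsometryEquiv {E H : Type*} [NormedAddCommGroup E]
    [InnerProductSpace ℝ E] [FiniteDimensional ℝ E] [MeasurableSpace E] [BorelSpace E]
    [NormedAddCommGroup H] [InnerProductSpace ℝ H] [FiniteDimensional ℝ H] [MeasurableSpace H]
    [BorelSpace H] (e : WithLp 2 (ℝ × H) ≃ₗᵢ[ℝ] E) :
    MeasurePreserving (fun p : ℝ × H => e (WithLp.toLp 2 p))
      ((volume : Measure ℝ).prod (volume : Measure H)) volume :=
  e.measurePreserving.comp (WithLp.volume_preserving_toLp ℝ H)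

/-- The isometry `(s, y) ↦ s θ + y`. -/
noncomputable def lineIsometry (θ : EuclideanSpace ℝ (Fin d)) (hθ : ‖θ‖ = 1) :
    WithLp 2 (ℝ × hyperplane θ) ≃ₗᵢ[ℝ] EuclideanSpace ℝ (Fin d) :=
  (LinearIsometryEquiv.withLpProdCongr 2 (LinearIsometryEquiv.toSpanUnitSingleton θ hθ)
    (LinearIsometryEquiv.refl ℝ (hyperplane θ))).trans
    (Submodule.span ℝ {θ}).orthogonalDecomposition.symm

theorem lineIsometry_apply (θ : EuclideanSpace ℝ (Fin d)) (hθ : ‖θ‖ = 1)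
    (p : ℝ × hyperplane θ) : lineIsometry θ hθ (WithLp.toLp 2 p) =
      p.1 • θ + (p.2 : EuclideanSpace ℝ (Fin d)) := by
  simp [lineIsometry]

/-- The linear homeomorphism `(s, y) ↦ s θ + y`. -/
noncomputable def lineEquiv (θ : EuclideanSpace ℝ (Fin d)) (hθ : ‖θ‖ = 1) :
    (ℝ × hyperplane θ) ≃L[ℝ] EuclideanSpace ℝ (Fin d) :=
  (WithLp.prodContinuousLinearEquiv 2 ℝ ℝ (hyperplane θ)).symm.trans
    (lineIsometry θ hθ).toContinuousLinearEquiv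

theorem lineEquiv_apply (θ : EuclideanSpace ℝ (Fin d)) (hθ : ‖θ‖ = 1) (s : ℝ)
    (y : hyperplane θ) :
    lineEquiv θ hθ (s, y) = s • θ + (y : EuclideanSpace ℝ (Fin d)) :=
  lineIsometry_apply θ hθ (s, y)

theorem measurePreserving_lineEquiv (θ : EuclideanSpace ℝ (Fin d)) (hθ : ‖θ‖ = 1) :
    MeasurePreserving (lineEquiv θ hθ) (volume.prod (hyperplaneMeasure θ)) volume :=
  measurePreserving_prod_of_linearIsometryEquiv (lineIsometry θ hθ)

instance sigmaFinite_hyperplaneMeasure (θ : EuclideanSpace ℝ (Fin d)) :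
    SigmaFinite (hyperplaneMeasure θ) := by
  have : Measure.IsAddHaarMeasure (hyperplaneMeasure θ) := by
    unfold hyperplaneMeasure
    infer_instance
  infer_instance

end Hyperplane

/-! ### The directional trace. -/

theorem mainTheorem2 (d : ℕ) (Ω : Set (EuclideanSpace ℝ (Fin d))) (hΩ : IsOpen Ω)
    (hΩb : Bornology.IsBounded Ω) (θ : EuclideanSpace ℝ (Fin d)) (hθ : ‖θ‖ = 1)
    (u : EuclideanSpace ℝ (Fin d) → ℝ) (hu : MemW Ω θ u) :
    ∃ g : frontier Ω → ℝ, Measurable g ∧ IsDirectionalTrace Ω θ u g := by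
  have hθ1 : lineEquiv θ hθ (1, 0) = θ := by simp [lineEquiv_apply]
  obtain ⟨G, hGm, hGu, hG⟩ := exists_measurable_representative
    (measurePreserving_lineEquiv θ hθ) hΩ hΩb (u := u) (by rwa [hθ1])
  simp only [lineEquiv_apply] at hG
  obtain ⟨A, hA, hGA⟩ := hG.exists_mem
  -- The same `G` is the representative and, on the frontier, the trace.
  refine ⟨fun x => G x, hGm.comp measurable_subtype_coe, G, hGu, shadow Ω θ ∩ A,
    inter_subset_left, ?_, fun y hy => ⟨(hGA y hy.2).1, fun α β hαβ => ?_⟩⟩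
  · rw [sdiff_self_inter]
    exact measure_mono_null (fun y hy => hy.2) (mem_ae_iff.1 hA)
  obtain ⟨hlt, hI, -, hβ⟩ := hαβ
  have hcl : β • θ + (y : EuclideanSpace ℝ (Fin d)) ∈ closure Ω := by
    have hmaps : MapsTo (fun s : ℝ => s • θ + (y : EuclideanSpace ℝ (Fin d))) (Ioo α β) Ω :=
      fun s hs => hI hs
    have hβc : β ∈ closure (Ioo α β) := by
      rw [closure_Ioo hlt.ne]
      exact right_mem_Icc.2 hlt.le
    exact hmaps.closure (by fun_prop) hβc
  refine ⟨_, (hGA y hy.2).2 α β hlt hI, fun s _ => rfl, ?_, rfl⟩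
  rw [hΩ.frontier_eq]
  exact ⟨hcl, hβ⟩
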